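/- Let $1\le p<\infty$ and let $\Gamma$ be an infinite set. For $0<q<\infty$ and $x\colon\Gamma\to\mathbb R$ write $\|x\|_q=\big(\sum_{\gamma\in\Gamma}|x(\gamma)|^q\big)^{1/q}$ and $\ell_q(\Gamma)=\{x\colon\Gamma\to\mathbb R : \|x\|_q<\infty\}$. Then $$\mathcal{Y}_p:=\{y\in\ell_p(\Gamma) : \|y\|_q<\infty\text{ for some }q\in(0,p)\}=\bigcup_{0<q<p}\ell_q(\Gamma)$$ is a dense linear subspace of the real Banach space $(\ell_p(\Gamma),\|\cdot\|_p)$. Moreover, for every $\varepsilon>0$ there is a norm $N$ on $\mathcal{Y}_p$, equivalent to $\|\cdot\|_p$, such that: (i) $N$ is $C^\infty$-smooth, that is, on $\mathcal{Y}_p\setminus\{0\}$ it has continuous Fréchet derivatives of every order; (ii) $N$ locally depends on finitely many coordinates (LFC), that is, for every $x\in\mathcal{Y}_p\setminus\{0\}$ there are an open neighbourhood $\mathcal U$ of $x$ in $\mathcal{Y}_p$, continuous linear functionals $\varphi_1,\dots,\varphi_k$ on $\mathcal{Y}_p$ and a $C^\infty$-smooth function $G\colon\mathbb R^k\to\mathbb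 R$ with $N(y)=G(\varphi_1(y),\dots,\varphi_k(y))$ for every $y\in\mathcal U$; (iii) $(1-\varepsilon)N(y)\le\|y\|_p\le(1+\varepsilon)N(y)$ for every $y\in\mathcal{Y}_p$. -/

import Mathlib

open scoped ENNReal ContDiff

/-- The real sequence space `ℓ_p(Γ)`. For `1 ≤ p < ∞` its norm is `(∑ |x γ| ^ p) ^ (1 / p)`. -/
abbrev RealLp (Γ : Type*) (p : ℝ≥0∞) : Type _ := lp (fun _ : Γ => ℝ) p

/-- The linear subspace `𝒴_p` of `ℓ_p(Γ)` of all `y` with `‖y‖_q < ∞` for some `q ∈ (0, p)`.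
It carries the norm `‖·‖_p` inherited from `ℓ_p(Γ)`. -/
def YSpace (Γ : Type*) (p : ℝ≥0∞) [Fact (1 ≤ p)] : Submodule ℝ (RealLp Γ p) where
  carrier := {y | ∃ q : ℝ≥0∞, 0 < q ∧ q < p ∧ Memℓp (fun γ => y γ) q}
  zero_mem' := by
    obtain ⟨q, hq0, hqp⟩ := exists_between (lt_of_lt_of_le one_pos (Fact.out : 1 ≤ p))
    exact ⟨q, hq0, hqp, zero_memℓp⟩
  add_mem' := by
    rintro a b ⟨q, hq0, hqp, ha⟩ ⟨r, hr0, hrp, hb⟩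
    exact ⟨max q r, lt_max_of_lt_left hq0, max_lt hqp hrp,
      (ha.of_exponent_ge (le_max_left q r)).add (hb.of_exponent_ge (le_max_right q r))⟩
  smul_mem' := by
    rintro c a ⟨q, hq0, hqp, ha⟩
    exact ⟨q, hq0, hqp, ha.const_smul c⟩

section Norms

variable {X : Type*} [NormedAddCommGroup X] [NormedSpace ℝ X]

/-- `N` is a norm on `X` equivalent to the given one: the lower bound makes the seminorm `N`
a norm. -/
def IsEquivalentNorm (N : Seminorm ℝ X) : Prop :=
  ∃ c C : ℝ, 0 < c ∧ 0 < C ∧ ∀ x, c * ‖x‖ ≤ N x ∧ N x ≤ C * ‖x‖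

/-- The norm `N` is `C^∞`-smooth: it has continuous Fréchet derivatives of all orders on
`X \ {0}`. (Fréchet differentiability depends only on the equivalence class of the norm of `X`.) -/
def IsSmoothNorm (N : Seminorm ℝ X) : Prop :=
  ContDiffOn ℝ ∞ (fun x => N x) {x : X | x ≠ 0}

/-- The norm `N` locally depends on finitely many coordinates. -/
def IsLFCNorm (N : Seminorm ℝ X) : Prop :=
  ∀ x : X, x ≠ 0 → ∃ U : Set X, IsOpen U ∧ x ∈ U ∧
    ∃ (k : ℕ) (φ : Fin k → StrongDual ℝ X) (G : (Fin k → ℝ) → ℝ),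
      ContDiff ℝ ∞ G ∧ ∀ y ∈ U, N y = G (fun i => φ i y)

end Norms

open Filter Topology

/-! `N` is the gauge of a convex symmetric body `C` squeezed between the ball of radius `1 - δ` and
the open unit ball. Fix weights `w n` decreasing to `0` more slowly than any power. Each finite `A ⊆
Γ` gets finitely many functionals of norm at most `1`, almost norming on the span of the coordinates
in `A`, and a smooth even convex `r` that vanishes up to `1 - w (2|A|)` and forces the truncation to
`A` to have norm at most `1 - w (2|A|+1)` when it is at most `1`. `C` bounds all finite sums of
these terms by `1`.

Membership in some `ℓ_q`, `q < p`, gives best `m`-term tails of power decay, which `w` dominates;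
hence points of `C` have norm strictly below `1` (`norm_lt_one_of_norm_lpTruncate_le`). Near such a
point only the sets `A` inside one finite `B` contribute (`eventually_abs_truncatedFunctional_le`):
large `A` have room because `w` tends to `0`, small ones because dropping a negligible coordinate
moves the bound past the gap between consecutive weights. So `C` is locally a smooth
finite-dimensional sublevel set, and the implicit function theorem makes its gauge smooth
(`exists_smooth_gauge_sublevelBody`). -/

/-! ### Smooth convex functions of one variable, flat near the origin. -/

theorem exists_contDiff_convexOn_zero_pos :
    ∃ h : ℝ → ℝ, ContDiff ℝ ∞ h ∧ ConvexOn ℝ Set.univ h ∧ Monotone h ∧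
      (∀ t ≤ 0, h t = 0) ∧ ∀ t, 0 < t → 0 < h t := by
  have hc : Continuous expNegInvGlue := (expNegInvGlue.contDiff (n := 0)).continuous
  have hd : ∀ t, HasDerivAt (fun t => ∫ s in (0 : ℝ)..t, expNegInvGlue s) (expNegInvGlue t) t :=
    fun t => hc.integral_hasStrictDerivAt 0 t |>.hasDerivAt
  have hderiv : deriv (fun t => ∫ s in (0 : ℝ)..t, expNegInvGlue s) = expNegInvGlue :=
    funext fun t => (hd t).deriv
  refine ⟨fun t => ∫ s in (0 : ℝ)..t, expNegInvGlue s, ?_, ?_, ?_, ?_, ?_⟩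
  · rw [contDiff_infty_iff_deriv, hderiv]
    exact ⟨fun t => (hd t).differentiableAt, expNegInvGlue.contDiff⟩
  · refine Monotone.convexOn_univ_of_deriv (fun t => (hd t).differentiableAt) ?_
    rw [hderiv]
    exact expNegInvGlue.monotone
  · refine monotone_of_deriv_nonneg (fun t => (hd t).differentiableAt) fun t => ?_
    rw [hderiv]
    exact expNegInvGlue.nonneg t
  · intro t ht
    beta_reduce
    rw [intervalIntegral.integral_congr (g := fun _ => 0)]
    · simp
    · intro s hs
      rw [Set.uIcc_of_ge ht] at hs
      exact expNegInvGlue.zero_of_nonpos hs.2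
  · intro t ht
    exact intervalIntegral.intervalIntegral_pos_of_pos_on (hc.intervalIntegrable _ _)
      (fun s hs => expNegInvGlue.pos_of_pos hs.1) ht

theorem exists_contDiff_convexOn_even {a b : ℝ} (hab : a < b) :
    ∃ r : ℝ → ℝ, ContDiff ℝ ∞ r ∧ ConvexOn ℝ Set.univ r ∧ (∀ s, r (-s) = r s) ∧ (∀ s, 0 ≤ r s) ∧
      (∀ s, |s| ≤ a → r s = 0) ∧ ∀ s, r s ≤ 1 → |s| ≤ b := by
  obtain ⟨h, hs, hc, hm, h0, hp⟩ := exists_contDiff_convexOn_zero_pos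
  have hnn : ∀ t, 0 ≤ h t := fun t => by
    rcases le_or_gt t 0 with ht | ht
    · exact (h0 t ht).ge
    · exact (hp t ht).le
  -- Any numerator above `1` works: the function is then at least `2` wherever `|s| > b`.
  set K : ℝ := 2 / h (b - a) with hK
  have hba : 0 < h (b - a) := hp _ (sub_pos.2 hab)
  have hK0 : 0 < K := by positivity
  refine ⟨fun s => K * (h (s - a) + h (-s - a)), ?_, ?_, ?_, ?_, ?_, ?_⟩
  · fun_prop
  · have h1 : ConvexOn ℝ Set.univ fun s => h (s - a) := by
      have := hc.translate_left (-a)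
      simpa [Function.comp_def, sub_eq_add_neg, add_comm] using this
    have h2 : ConvexOn ℝ Set.univ fun s => h (-s - a) := by
      have := h1.comp_linearMap (-LinearMap.id)
      simpa [Function.comp_def] using this
    simpa [Pi.add_apply, smul_eq_mul] using (h1.add h2).smul hK0.le
  · intro s
    simp only [neg_neg]
    ring
  · intro s
    have := hnn (s - a)
    have := hnn (-s - a)
    positivity
  · intro s hsa
    obtain ⟨h1, h2⟩ := abs_le.1 hsa
    simp only
    rw [h0 (s - a) (by linarith), h0 (-s - a) (by linarith)]
    simp
  · intro s hs1
    by_contra! hb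
    have key : h (b - a) ≤ h (s - a) + h (-s - a) := by
      rcases lt_abs.1 hb with h1 | h1
      · linarith [hm (show b - a ≤ s - a by linarith), hnn (-s - a)]
      · linarith [hm (show b - a ≤ -s - a by linarith), hnn (s - a)]
    have : K * h (b - a) = 2 := by rw [hK]; field_simp
    have := mul_le_mul_of_nonneg_left key hK0.le
    simp only at hs1
    linarith

/-! ### Smoothness of the gauge of a smooth convex sublevel set. -/

theorem setOf_le_one_mem_nhds_zero {E : Type*} [NormedAddCommGroup E] {F : E → ℝ}
    (hF : Continuous F) (h0 : F 0 = 0) :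
    {u | F u ≤ 1} ∈ 𝓝 (0 : E) :=
  mem_of_superset ((isOpen_lt hF continuous_const).mem_nhds
    (show F 0 < 1 from h0.trans_lt one_pos)) fun u (hu : F u < 1) => hu.le

section Gauge

variable {E : Type*} [NormedAddCommGroup E] [NormedSpace ℝ E]

theorem gauge_pos_smul {s : Set E} {a : ℝ} (ha : 0 ≤ a) (x : E) :
    gauge s (a • x) = a * gauge s x := by
  simpa using gauge_smul_of_nonneg (s := s) ha x

theorem gauge_inv_gauge_smul_self {s : Set E} {x : E} (hx : 0 < gauge s x) :
    gauge s ((gauge s x)⁻¹ • x) = 1 := by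
  rw [gauge_pos_smul (inv_nonneg.2 hx.le), inv_mul_cancel₀ hx.ne']

theorem gauge_setOf_le_one_eq_one_iff {F : E → ℝ} (hF : Continuous F)
    (hc : ConvexOn ℝ Set.univ F) (h0 : F 0 = 0) (u : E) :
    gauge {u | F u ≤ 1} u = 1 ↔ F u = 1 := by
  have hD : {u | F u ≤ 1} ∈ 𝓝 (0 : E) := setOf_le_one_mem_nhds_zero hF h0
  have hconv : Convex ℝ {u | F u ≤ 1} := by simpa using hc.convex_le 1
  constructor
  · intro h
    exact frontier_le_subset_eq hF continuous_const
      ((gauge_eq_one_iff_mem_frontier hconv hD).1 h)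
  · intro h
    refine le_antisymm (gauge_le_one_of_mem h.le) (not_lt.1 fun hlt => ?_)
    obtain ⟨b, hb0, hb1, d, hd, rfl⟩ := exists_lt_of_gauge_lt (absorbent_nhds_zero hD) hlt
    have := hc.2 (Set.mem_univ d) (Set.mem_univ 0) hb0.le (sub_nonneg.2 hb1.le) (by ring)
    simp only [smul_zero, add_zero, h0, smul_eq_mul, mul_zero] at this
    have hd' : F d ≤ 1 := hd
    simp only at h
    nlinarith

/-- Along the ray through `w`, the secant slope from `0` to `1` is at most the derivative at `1`.
Where `F = 1`, the radial derivative is therefore nonzero. -/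
theorem ConvexOn.le_fderiv_self {F : E → ℝ} (hc : ConvexOn ℝ Set.univ F) (h0 : F 0 = 0) {w : E}
    (hd : DifferentiableAt ℝ F w) : F w ≤ fderiv ℝ F w w := by
  have hline : HasDerivAt (fun s : ℝ => F (s • w)) (fderiv ℝ F w w) 1 := by
    have h1 : HasDerivAt (fun s : ℝ => s • w) w 1 := by
      simpa using (hasDerivAt_id (1 : ℝ)).smul_const w
    have h2 : HasFDerivAt F (fderiv ℝ F w) ((1 : ℝ) • w) := by simpa using hd.hasFDerivAt
    exact h2.comp_hasDerivAt 1 h1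
  have hconv : ConvexOn ℝ Set.univ fun s : ℝ => F (s • w) := by
    simpa [Function.comp_def] using hc.comp_linearMap (LinearMap.toSpanSingleton ℝ E w)
  have := hconv.slope_le_of_hasDerivAt (Set.mem_univ 0) (Set.mem_univ 1) one_pos hline
  simpa [slope_def_field, h0] using this

theorem ContinuousLinearMap.isInvertible_of_apply_one_ne_zero {f : ℝ →L[ℝ] ℝ} (hf : f 1 ≠ 0) :
    f.IsInvertible := by
  refine ⟨ContinuousLinearEquiv.unitsEquivAut ℝ (Units.mk0 _ hf), ?_⟩
  ext
  simp

/-- The gauge solves `F (t⁻¹ • v) = 1` for `t`; the implicit function theorem applies since the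
`t`-derivative is a nonzero multiple of the radial derivative of `F`. -/
theorem contDiffAt_gauge_setOf_le_one [CompleteSpace E] {F : E → ℝ} (hF : ContDiff ℝ ∞ F)
    (hc : ConvexOn ℝ Set.univ F) (h0 : F 0 = 0) {u : E} (hu : 0 < gauge {u | F u ≤ 1} u) :
    ContDiffAt ℝ ∞ (gauge {u | F u ≤ 1}) u := by
  have hD : {u | F u ≤ 1} ∈ 𝓝 (0 : E) := setOf_le_one_mem_nhds_zero hF.continuous h0
  have hconv : Convex ℝ {u | F u ≤ 1} := by simpa using hc.convex_le 1
  set G : E → ℝ := gauge {u | F u ≤ 1} with hG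
  have hGc : Continuous G := continuous_gauge hconv hD
  have hone : ∀ v, 0 < G v → F ((G v)⁻¹ • v) = 1 := fun v hv =>
    (gauge_setOf_le_one_eq_one_iff hF.continuous hc h0 _).1 (gauge_inv_gauge_smul_self hv)
  let Φ : E × ℝ → ℝ := fun v => F (v.2⁻¹ • v.1)
  have hΦ : ContDiffAt ℝ ∞ Φ (u, G u) := by
    refine hF.contDiffAt.comp _ (ContDiffAt.smul (ContDiffAt.inv contDiffAt_snd hu.ne')
      contDiffAt_fst)
  have hn : (∞ : ℕ∞ω) ≠ 0 := by simp
  have hinv : (fderiv ℝ Φ (u, G u) ∘L .inr ℝ E ℝ).IsInvertible := by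
    apply ContinuousLinearMap.isInvertible_of_apply_one_ne_zero
    have hΦd : HasFDerivAt Φ (fderiv ℝ Φ (u, G u)) (u, G u) :=
      (hΦ.differentiableAt hn).hasFDerivAt
    have h1 : HasDerivAt (fun t : ℝ => Φ (u, t)) (fderiv ℝ Φ (u, G u) (0, 1)) (G u) :=
      hΦd.comp_hasDerivAt (G u) ((hasDerivAt_const (G u) u).prodMk (hasDerivAt_id (G u)))
    have h2 : HasDerivAt (fun t : ℝ => Φ (u, t))
        (fderiv ℝ F ((G u)⁻¹ • u) ((-(G u ^ 2)⁻¹) • u)) (G u) :=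
      (hF.differentiable hn _).hasFDerivAt.comp_hasDerivAt (G u)
        ((hasDerivAt_inv hu.ne').smul_const u)
    have h3 := hc.le_fderiv_self h0 (hF.differentiable hn ((G u)⁻¹ • u))
    rw [hone u hu, map_smul, smul_eq_mul] at h3
    have h4 : fderiv ℝ F ((G u)⁻¹ • u) u ≠ 0 := by
      intro h
      rw [h, mul_zero] at h3
      linarith
    simp only [ContinuousLinearMap.comp_apply, ContinuousLinearMap.inr_apply]
    rw [h1.unique h2, map_smul, smul_eq_mul]
    exact mul_ne_zero (by simp [hu.ne']) h4
  have hev := hΦ.eventually_apply_eq_iff_implicitFunction hn hinv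
  have htend : Tendsto (fun v => (v, G v)) (𝓝 u) (𝓝 (u, G u)) :=
    (continuous_id.prodMk hGc).tendsto u
  refine (hΦ.contDiffAt_implicitFunction hn hinv).congr_of_eventuallyEq ?_
  filter_upwards [htend.eventually hev, hGc.continuousAt.eventually (lt_mem_nhds hu)] with v hv hvp
  exact (hv.1 ((hone v hvp).trans (hone u hu).symm)).symm

/-- Multiplying by a bump function turns a local smooth function into the global one that LFC asks
for. -/
theorem exists_contDiff_eventuallyEq [FiniteDimensional ℝ E] {G : E → ℝ} {u : E}
    (hG : ∀ᶠ v in 𝓝 u, ContDiffAt ℝ ∞ G v) :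
    ∃ H : E → ℝ, ContDiff ℝ ∞ H ∧ H =ᶠ[𝓝 u] G := by
  obtain ⟨r, hr, hball⟩ := Metric.nhds_basis_closedBall.mem_iff.1 hG
  let f : ContDiffBump u := ⟨r / 2, r, half_pos hr, half_lt_self hr⟩
  refine ⟨fun v => f v * G v, contDiff_iff_contDiffAt.2 fun v => ?_, ?_⟩
  · by_cases hv : v ∈ tsupport f
    · rw [f.tsupport_eq] at hv
      exact f.contDiff.contDiffAt.mul (hball hv)
    · refine contDiffAt_const (c := (0 : ℝ)) |>.congr_of_eventuallyEq ?_
      filter_upwards [notMem_tsupport_iff_eventuallyEq.1 hv] with z hz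
      simp [hz]
  · filter_upwards [f.eventuallyEq_one] with v hv
    simp [hv]

end Gauge

/-! ### Bodies cut out by a locally finite family of convex functions. -/

section SublevelBody

variable {X ι : Type*} [NormedAddCommGroup X] [NormedSpace ℝ X]

/-- The vectors at which every finite partial sum of the family `r i ∘ φ i` is at most `1`. -/
def sublevelBody (φ : ι → StrongDual ℝ X) (r : ι → ℝ → ℝ) : Set X :=
  {x | ∀ J : Finset ι, ∑ i ∈ J, r i (φ i x) ≤ 1}

variable {φ : ι → StrongDual ℝ X} {r : ι → ℝ → ℝ}

theorem convex_sublevelBody (hc : ∀ i, ConvexOn ℝ Set.univ (r i)) :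
    Convex ℝ (sublevelBody φ r) := by
  intro x hx y hy s t hs ht hst J
  calc ∑ i ∈ J, r i (φ i (s • x + t • y))
      ≤ ∑ i ∈ J, (s * r i (φ i x) + t * r i (φ i y)) := by
        refine Finset.sum_le_sum fun i _ => ?_
        have := (hc i).2 (Set.mem_univ (φ i x)) (Set.mem_univ (φ i y)) hs ht hst
        simpa using this
    _ = s * ∑ i ∈ J, r i (φ i x) + t * ∑ i ∈ J, r i (φ i y) := by
        rw [Finset.sum_add_distrib, Finset.mul_sum, Finset.mul_sum]
    _ ≤ s * 1 + t * 1 := by gcongr; exacts [hx J, hy J]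
    _ = 1 := by rw [mul_one, mul_one, hst]

theorem isClosed_sublevelBody (hr : ∀ i, Continuous (r i)) : IsClosed (sublevelBody φ r) := by
  simp only [sublevelBody, Set.ofPred_forall]
  exact isClosed_iInter fun J => isClosed_le
    (continuous_finsetSum _ fun i _ => (hr i).comp (φ i).continuous) continuous_const

theorem neg_mem_sublevelBody (he : ∀ i s, r i (-s) = r i s) {x : X} (hx : x ∈ sublevelBody φ r) :
    -x ∈ sublevelBody φ r := by
  intro J
  simpa [he] using hx J

theorem balanced_sublevelBody (hc : ∀ i, ConvexOn ℝ Set.univ (r i))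
    (he : ∀ i s, r i (-s) = r i s) (hz : ∀ i, r i 0 = 0) :
    Balanced ℝ (sublevelBody φ r) := by
  have hstar : StarConvex ℝ 0 (sublevelBody φ r) :=
    (convex_sublevelBody hc).starConvex fun J => by simp [hz]
  rintro a ha _ ⟨x, hx, rfl⟩
  rw [Real.norm_eq_abs] at ha
  rcases le_total 0 a with h | h
  · exact hstar.smul_mem hx h (by rwa [abs_of_nonneg h] at ha)
  · have := hstar.smul_mem (neg_mem_sublevelBody he hx) (neg_nonneg.2 h)
      (by rwa [abs_of_nonpos h] at ha)
    simpa using this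

theorem exists_smooth_gauge_sublevelBody (hr : ∀ i, ContDiff ℝ ∞ (r i))
    (hc : ∀ i, ConvexOn ℝ Set.univ (r i)) (hz : ∀ i, r i 0 = 0) (hnn : ∀ i s, 0 ≤ r i s)
    (h0 : sublevelBody φ r ∈ 𝓝 (0 : X))
    (hloc : ∀ x ∈ sublevelBody φ r, ∃ J : Finset ι, ∀ᶠ y in 𝓝 x, ∀ i ∉ J, r i (φ i y) = 0)
    {x : X} (hx : 0 < gauge (sublevelBody φ r) x) :
    ∃ (k : ℕ) (ψ : Fin k → StrongDual ℝ X) (G : (Fin k → ℝ) → ℝ), ContDiff ℝ ∞ G ∧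
      ∀ᶠ y in 𝓝 x, gauge (sublevelBody φ r) y = G fun i => ψ i y := by
  set C := sublevelBody φ r with hC
  set N := gauge C with hN
  have hconv : Convex ℝ C := convex_sublevelBody hc
  have hclosed : IsClosed C := isClosed_sublevelBody fun i => (hr i).continuous
  have hNc : Continuous N := continuous_gauge hconv h0
  have hmem : ∀ z, N z = 1 → z ∈ C := fun z hz1 => by
    have := (gauge_le_one_iff_mem_closure hconv h0).1 hz1.le
    rwa [hclosed.closure_eq] at this
  obtain ⟨J, hJ⟩ := hloc _ (hmem _ (gauge_inv_gauge_smul_self hx))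
  let e := J.equivFin
  let ψ : Fin J.card → StrongDual ℝ X := fun i => φ (e.symm i)
  let F : (Fin J.card → ℝ) → ℝ := fun u => ∑ i, r (e.symm i) (u i)
  let T : X → Fin J.card → ℝ := fun y i => ψ i y
  have hTc : Continuous T := continuous_pi fun i => (ψ i).continuous
  have hF : ContDiff ℝ ∞ F := ContDiff.sum fun i _ => (hr _).comp (contDiff_apply ℝ ℝ i)
  have hF0 : F 0 = 0 := by simp [F, hz]
  have hFc : ConvexOn ℝ Set.univ F := by
    refine ⟨convex_univ, fun u _ v _ s t hs ht hst => ?_⟩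
    simp only [F, smul_eq_mul, Finset.mul_sum, ← Finset.sum_add_distrib]
    refine Finset.sum_le_sum fun i _ => ?_
    simpa using (hc (e.symm i)).2 (Set.mem_univ (u i)) (Set.mem_univ (v i)) hs ht hst
  have hFT : ∀ y, F (T y) = ∑ i ∈ J, r i (φ i y) := fun y => by
    rw [← Finset.sum_coe_sort J fun i => r i (φ i y)]
    exact e.symm.sum_comp fun i : J => r i (φ i y)
  have hle : ∀ z ∈ C, F (T z) ≤ 1 := fun z hzC => (hFT z).trans_le (hzC J)
  have hge : ∀ z, (∀ i ∉ J, r i (φ i z) = 0) → F (T z) ≤ 1 → z ∈ C := by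
    classical
    intro z hzJ hz1 K
    refine le_trans ?_ ((hFT z).symm.trans_le hz1)
    rw [← Finset.sum_filter_add_sum_filter_not K (· ∈ J),
      Finset.sum_eq_zero (s := K.filter (· ∉ J)) fun i hi => hzJ i (Finset.mem_filter.1 hi).2,
      add_zero]
    exact Finset.sum_le_sum_of_subset_of_nonneg (fun i hi => (Finset.mem_filter.1 hi).2)
      fun i _ _ => hnn _ _
  -- Were `F (T z) < 1`, continuity and local finiteness would put `z` in the interior of `C`, where
  -- the gauge is below `1`.
  have hone : ∀ z, (∀ᶠ y in 𝓝 z, ∀ i ∉ J, r i (φ i y) = 0) → N z = 1 → F (T z) = 1 := by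
    intro z hev hz1
    refine le_antisymm (hle z (hmem z hz1)) (not_lt.1 fun hlt => ?_)
    have hint : z ∈ interior C := by
      rw [mem_interior_iff_mem_nhds]
      filter_upwards [hev, (hF.continuous.comp hTc).continuousAt.eventually (gt_mem_nhds hlt)]
        with y hy hy1
      exact hge y hy hy1.le
    exact ((gauge_lt_one_iff_mem_interior hconv h0).2 hint).ne hz1
  set G := gauge {u | F u ≤ 1} with hG
  have hGc : Continuous G := continuous_gauge (by simpa using hFc.convex_le 1)
    (setOf_le_one_mem_nhds_zero hF.continuous hF0)
  have hNG : ∀ᶠ y in 𝓝 x, N y = G (T y) := by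
    have htend : ContinuousAt (fun y => (N y)⁻¹ • y) x :=
      (hNc.continuousAt.inv₀ hx.ne').smul continuousAt_id
    -- `hone` needs local finiteness on a neighbourhood of each normalized `y`, not only at that
    -- point.
    filter_upwards [htend.eventually hJ.eventually_nhds,
      hNc.continuousAt.eventually (lt_mem_nhds hx)] with y hy hyp
    have h1 := (gauge_setOf_le_one_eq_one_iff hF.continuous hFc hF0 _).2
      (hone _ hy (gauge_inv_gauge_smul_self hyp))
    have h2 : T ((N y)⁻¹ • y) = (N y)⁻¹ • T y := by
      ext i
      simp [T]
    rw [h2, gauge_pos_smul (inv_nonneg.2 hyp.le)] at h1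
    field_simp at h1
    exact h1.symm
  have hGx : 0 < G (T x) := hNG.self_of_nhds ▸ hx
  obtain ⟨H, hH, hHG⟩ := exists_contDiff_eventuallyEq (G := G) (u := T x) <| by
    filter_upwards [hGc.continuousAt.eventually (lt_mem_nhds hGx)] with v hv
    exact contDiffAt_gauge_setOf_le_one hF hFc hF0 hv
  refine ⟨J.card, ψ, H, hH, ?_⟩
  filter_upwards [hNG, hTc.continuousAt.eventually hHG] with y hy hy2
  rw [hy, ← hy2]

end SublevelBody

/-! ### General tools: LFC implies smooth, finite norming sets, slow weights. -/

theorem IsLFCNorm.isSmoothNorm {X : Type*} [NormedAddCommGroup X] [NormedSpace ℝ X]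
    {N : Seminorm ℝ X} (hN : IsLFCNorm N) : IsSmoothNorm N := by
  intro x hx
  obtain ⟨U, hU, hxU, k, φ, G, hG, h⟩ := hN x hx
  have hφ : ContDiff ℝ ∞ fun y i => φ i y := contDiff_pi.2 fun i => (φ i).contDiff
  refine ((hG.comp hφ).contDiffAt.congr_of_eventuallyEq ?_).contDiffWithinAt
  filter_upwards [hU.mem_nhds hxU] with y hy using h y hy

/-- Compactness of the unit sphere of `V`: finitely many supporting functionals exceed `κ` somewhere
around each of its points. -/
theorem exists_finset_dual_norming {X : Type*} [NormedAddCommGroup X] [NormedSpace ℝ X]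
    (V : Submodule ℝ X) [FiniteDimensional ℝ V] {κ : ℝ} (hκ1 : κ < 1) :
    ∃ F : Finset (StrongDual ℝ X), (∀ f ∈ F, ‖f‖ ≤ 1) ∧
      ∀ v ∈ V, ∀ b, 0 ≤ b → (∀ f ∈ F, |f v| ≤ b) → κ * ‖v‖ ≤ b := by
  classical
  choose g hg1 hg2 using fun v : X => exists_dual_vector'' ℝ v
  obtain ⟨t, -, ht⟩ := (isCompact_sphere (0 : V) 1).elim_finite_subcover_image
    (b := Metric.sphere (0 : V) 1) (c := fun v => {w : V | κ < g v w})
    (fun v _ => isOpen_lt continuous_const ((g v).continuous.comp continuous_subtype_val))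
    (fun v hv => by
      refine Set.mem_biUnion hv ?_
      have : ‖(v : X)‖ = 1 := by simpa using hv
      simpa [hg2, this] using hκ1)
  obtain ⟨hfin, hcov⟩ := ht
  refine ⟨hfin.toFinset.image fun v : V => g (v : X), ?_, ?_⟩
  · intro f hf
    obtain ⟨v, -, rfl⟩ := Finset.mem_image.1 hf
    exact hg1 v
  · intro v hv b hb h
    rcases eq_or_ne v 0 with rfl | hv0
    · simpa using hb
    have hpos : 0 < ‖v‖ := norm_pos_iff.2 hv0
    obtain ⟨u, hu, huw⟩ := Set.mem_iUnion₂.1 (hcov (show (‖v‖⁻¹ • ⟨v, hv⟩ : V) ∈ _ by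
      simp [norm_smul, hpos.ne']))
    have h1 : κ < ‖v‖⁻¹ * g u v := by simpa using huw
    have h2 := (le_abs_self _).trans (h (g u) (Finset.mem_image.2 ⟨u, hfin.mem_toFinset.2 hu, rfl⟩))
    rw [inv_mul_eq_div, lt_div_iff₀ hpos] at h1
    linarith

/-- Reciprocal logarithms decay more slowly than every negative power. The shift by `3 > e` keeps
the logarithm above `1`, hence the weights below `δ`. -/
theorem exists_strictAnti_dominating_rpow {δ : ℝ} (hδ : 0 < δ) :
    ∃ w : ℕ → ℝ, StrictAnti w ∧ (∀ n, 0 < w n) ∧ (∀ n, w n < δ) ∧ Tendsto w atTop (𝓝 0) ∧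
      ∀ s K : ℝ, 0 < s → ∃ m : ℕ, 0 < m ∧ K * (m : ℝ) ^ (-s) < w (2 * m + 1) := by
  have hlog : ∀ n : ℕ, 1 < Real.log (n + 3) := fun n => by
    rw [Real.lt_log_iff_exp_lt (by positivity)]
    have := Real.exp_one_lt_d9
    have : (0 : ℝ) ≤ n := n.cast_nonneg
    linarith
  have htop : Tendsto (fun n : ℕ => (n : ℝ) + 3) atTop atTop :=
    tendsto_natCast_atTop_atTop.atTop_add tendsto_const_nhds
  refine ⟨fun n => δ / Real.log (n + 3), ?_, ?_, ?_, ?_, ?_⟩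
  · refine strictAnti_nat_of_succ_lt fun n => ?_
    refine div_lt_div_of_pos_left hδ (by linarith [hlog n]) (Real.log_lt_log (by positivity) ?_)
    push_cast
    linarith
  · exact fun n => div_pos hδ (by linarith [hlog n])
  · exact fun n => div_lt_self hδ (hlog n)
  · exact tendsto_const_nhds.div_atTop (Real.tendsto_log_atTop.comp htop)
  · intro s K hs
    have h1 : Tendsto (fun m : ℕ => Real.log (m : ℝ) / (m : ℝ) ^ s) atTop (𝓝 0) :=
      (isLittleO_log_rpow_atTop hs).tendsto_div_nhds_zero.comp tendsto_natCast_atTop_atTop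
    have h2 : Tendsto (fun m : ℕ => Real.log 6 / (m : ℝ) ^ s) atTop (𝓝 0) :=
      tendsto_const_nhds.div_atTop ((tendsto_rpow_atTop hs).comp tendsto_natCast_atTop_atTop)
    have h3 := (h1.add h2).const_mul |K|
    simp only [add_zero, mul_zero] at h3
    obtain ⟨m, hm, hm0⟩ := ((h3.eventually (gt_mem_nhds hδ)).and (eventually_gt_atTop 0)).exists
    refine ⟨m, hm0, ?_⟩
    have hm1 : (1 : ℝ) ≤ m := by exact_mod_cast hm0
    have hms : 0 < (m : ℝ) ^ s := Real.rpow_pos_of_pos (by linarith) s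
    have hl : Real.log ((2 * m + 1 : ℕ) + 3) ≤ Real.log m + Real.log 6 := by
      rw [← Real.log_mul (by linarith) (by norm_num)]
      refine Real.log_le_log (by positivity) ?_
      push_cast
      linarith
    rw [lt_div_iff₀ (by linarith [hlog (2 * m + 1)]), Real.rpow_neg (by linarith)]
    calc K * ((m : ℝ) ^ s)⁻¹ * Real.log ((2 * m + 1 : ℕ) + 3)
        ≤ |K| * ((m : ℝ) ^ s)⁻¹ * (Real.log m + Real.log 6) := by
          gcongr
          · linarith [hlog (2 * m + 1)]
          · exact le_abs_self K
      _ = |K| * (Real.log m / (m : ℝ) ^ s + Real.log 6 / (m : ℝ) ^ s) := by ring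
      _ < δ := hm

/-! ### Truncations in `ℓ_p(Γ)` and power decay of tails on `𝒴_p`. -/

section Truncation

variable {Γ : Type*} {p : ℝ≥0∞} [Fact (1 ≤ p)]

open Classical in
/-- The restriction of a vector of `ℓ_p(Γ)` to a finite set of coordinates. -/
noncomputable def lpTruncate (Γ : Type*) (p : ℝ≥0∞) [Fact (1 ≤ p)] (A : Finset Γ) :
    RealLp Γ p →L[ℝ] RealLp Γ p :=
  ∑ i ∈ A, lp.singleContinuousLinearMap ℝ (fun _ : Γ => ℝ) p i ∘L
    lp.evalCLM ℝ (fun _ : Γ => ℝ) p i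

open Classical in
theorem lpTruncate_apply (A : Finset Γ) (y : RealLp Γ p) :
    lpTruncate Γ p A y = ∑ i ∈ A, lp.single p i (y i) := by
  simp only [lpTruncate, _root_.sum_apply]
  rfl

theorem toReal_pos_of_fact (hp : p ≠ ⊤) : 0 < p.toReal :=
  ENNReal.toReal_pos (one_pos.trans_le (Fact.out : 1 ≤ p)).ne' hp

theorem norm_lpTruncate_rpow (hp : p ≠ ⊤) (A : Finset Γ) (y : RealLp Γ p) :
    ‖lpTruncate Γ p A y‖ ^ p.toReal = ∑ i ∈ A, ‖y i‖ ^ p.toReal := by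
  classical
  rw [lpTruncate_apply]
  exact lp.norm_sum_single (toReal_pos_of_fact hp) _ A

theorem norm_lpTruncate_le (hp : p ≠ ⊤) (A : Finset Γ) (y : RealLp Γ p) :
    ‖lpTruncate Γ p A y‖ ≤ ‖y‖ := by
  have hp0 := toReal_pos_of_fact hp
  rw [← Real.rpow_le_rpow_iff (norm_nonneg _) (norm_nonneg _) hp0, norm_lpTruncate_rpow hp]
  exact lp.sum_rpow_le_norm_rpow hp0 y A

theorem norm_lpTruncate_le_erase [DecidableEq Γ] {A : Finset Γ} {γ : Γ} (hγ : γ ∈ A)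
    (y : RealLp Γ p) :
    ‖lpTruncate Γ p A y‖ ≤ ‖lpTruncate Γ p (A.erase γ) y‖ + |y γ| := by
  classical
  have h : lpTruncate Γ p A y = lpTruncate Γ p (A.erase γ) y + lp.single p γ (y γ) := by
    rw [lpTruncate_apply, lpTruncate_apply, ← Finset.sum_erase_add A _ hγ]
    congr!
  rw [h]
  refine (norm_add_le _ _).trans_eq ?_
  rw [lp.norm_single (one_pos.trans_le Fact.out), Real.norm_eq_abs]

theorem exists_finset_dual_norming_lpTruncate (A : Finset Γ) {κ : ℝ} (hκ1 : κ < 1) :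
    ∃ F : Finset (StrongDual ℝ (RealLp Γ p)), (∀ f ∈ F, ‖f‖ ≤ 1) ∧
      ∀ y b, 0 ≤ b → (∀ f ∈ F, |f (lpTruncate Γ p A y)| ≤ b) → κ * ‖lpTruncate Γ p A y‖ ≤ b := by
  classical
  let S : Finset (RealLp Γ p) := A.image fun i => lp.single p i (1 : ℝ)
  obtain ⟨F, hF1, hF2⟩ := exists_finset_dual_norming
    (Submodule.span ℝ (S : Set (RealLp Γ p))) hκ1
  refine ⟨F, hF1, fun y => hF2 _ ?_⟩
  rw [lpTruncate_apply]
  refine Submodule.sum_mem _ fun i hi => ?_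
  have h : lp.single (E := fun _ : Γ => ℝ) p i (y i) = y i • lp.single p i (1 : ℝ) := by
    rw [← lp.single_smul]
    simp
  rw [h]
  exact Submodule.smul_mem _ _ (Submodule.subset_span (Finset.mem_image_of_mem _ hi))

theorem Memℓp.finite_setOf_lt_norm {f : Γ → ℝ} {q : ℝ≥0∞} (hf : Memℓp f q) (hq : 0 < q.toReal)
    {t : ℝ} (ht : 0 < t) : {γ | t < ‖f γ‖}.Finite := by
  have := (hf.summable hq).tendsto_cofinite_zero.eventually
    (gt_mem_nhds (Real.rpow_pos_of_pos ht q.toReal))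
  refine (Filter.eventually_cofinite.1 this).subset fun γ hγ => ?_
  exact not_lt.2 (Real.rpow_le_rpow ht.le (le_of_lt hγ) hq.le)

/-- Keep the coordinates above a threshold `t`. Markov's inequality for the `q`-sum counts them, and
on the rest `|y γ|^p ≤ t^(p-q) |y γ|^q`. -/
theorem exists_finset_card_le_tail_le (hp : p ≠ ⊤) {q : ℝ≥0∞} (hq0 : 0 < q) (hqp : q < p)
    (y : RealLp Γ p) (hy : Memℓp (fun γ => y γ) q) :
    ∃ s K : ℝ, 0 < s ∧ ∀ m : ℕ, 0 < m → ∃ A : Finset Γ, A.card ≤ m ∧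
      ‖y‖ ^ p.toReal ≤ ‖lpTruncate Γ p A y‖ ^ p.toReal + K * (m : ℝ) ^ (-s) := by
  classical
  have hqt : q ≠ ⊤ := (hqp.trans_le le_top).ne
  have hq : 0 < q.toReal := ENNReal.toReal_pos hq0.ne' hqt
  have hpq : q.toReal < p.toReal := (ENNReal.toReal_lt_toReal hqt hp).2 hqp
  have hsum : Summable fun γ => ‖y γ‖ ^ q.toReal := hy.summable hq
  set M : ℝ := (∑' γ, ‖y γ‖ ^ q.toReal) + 1 with hM
  have hS0 : 0 ≤ ∑' γ, ‖y γ‖ ^ q.toReal := tsum_nonneg fun γ => by positivity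
  have hM0 : 0 < M := by positivity
  refine ⟨(p.toReal - q.toReal) / q.toReal, M ^ ((p.toReal - q.toReal) / q.toReal) * M,
    div_pos (sub_pos.2 hpq) hq, fun m hm => ?_⟩
  have hm0 : (0 : ℝ) < m := Nat.cast_pos.2 hm
  -- Chosen so that `t ^ q = M / m`, which allows at most `m` coordinates above `t`.
  set t : ℝ := (M / m) ^ (q.toReal)⁻¹ with ht
  have ht0 : 0 < t := by positivity
  have htq : t ^ q.toReal = M / m := Real.rpow_inv_rpow (by positivity) hq.ne'
  have hfin := hy.finite_setOf_lt_norm hq ht0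
  refine ⟨hfin.toFinset, ?_, ?_⟩
  · have h1 : hfin.toFinset.card • (M / m) ≤ ∑ γ ∈ hfin.toFinset, ‖y γ‖ ^ q.toReal := by
      refine Finset.card_nsmul_le_sum _ _ _ fun γ hγ => ?_
      rw [← htq]
      exact Real.rpow_le_rpow ht0.le (le_of_lt (hfin.mem_toFinset.1 hγ)) hq.le
    have h2 := h1.trans (hsum.sum_le_tsum _ fun γ _ => by positivity)
    have h3 : hfin.toFinset.card * (M / m) ≤ M := by
      rw [nsmul_eq_mul] at h2
      linarith
    have h4 : (hfin.toFinset.card : ℝ) ≤ m := by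
      rw [mul_div_assoc', div_le_iff₀ hm0, mul_comm M] at h3
      exact le_of_mul_le_mul_right h3 hM0
    exact_mod_cast h4
  · have hA : HasSum (fun γ => if γ ∈ hfin.toFinset then ‖y γ‖ ^ p.toReal else 0)
        (‖lpTruncate Γ p hfin.toFinset y‖ ^ p.toReal) := by
      rw [norm_lpTruncate_rpow hp, Finset.sum_congr rfl fun γ hγ => (if_pos hγ).symm]
      exact hasSum_sum_of_ne_finset_zero fun γ hγ => if_neg hγ
    have hle := hasSum_le (fun γ => ?_) (lp.hasSum_norm (toReal_pos_of_fact hp) y)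
      (hA.add (hsum.hasSum.mul_left (t ^ (p.toReal - q.toReal))))
    · refine hle.trans (add_le_add le_rfl ?_)
      have h5 : t ^ (p.toReal - q.toReal) =
          M ^ ((p.toReal - q.toReal) / q.toReal) * (m : ℝ) ^ (-((p.toReal - q.toReal) / q.toReal)) := by
        rw [ht, ← Real.rpow_mul (by positivity), Real.div_rpow hM0.le hm0.le,
          Real.rpow_neg hm0.le, inv_mul_eq_div, div_eq_mul_inv]
      calc t ^ (p.toReal - q.toReal) * ∑' γ, ‖y γ‖ ^ q.toReal
          ≤ t ^ (p.toReal - q.toReal) * M := by gcongr; linarith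
        _ = _ := by rw [h5]; ring
    · by_cases hγ : γ ∈ hfin.toFinset
      · rw [if_pos hγ]
        exact le_add_of_nonneg_right (by positivity)
      · rw [if_neg hγ, zero_add]
        have hγ' : ‖y γ‖ ≤ t := not_lt.1 fun h => hγ (hfin.mem_toFinset.2 h)
        calc ‖y γ‖ ^ p.toReal = ‖y γ‖ ^ (p.toReal - q.toReal) * ‖y γ‖ ^ q.toReal := by
              rw [← Real.rpow_add_of_nonneg (norm_nonneg _) (sub_pos.2 hpq).le hq.le,
                sub_add_cancel]
          _ ≤ _ := by gcongr

theorem norm_lt_one_of_norm_lpTruncate_le (hp : p ≠ ⊤) {w : ℕ → ℝ} (hanti : StrictAnti w)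
    (hpos : ∀ n, 0 < w n)
    (hdom : ∀ s K : ℝ, 0 < s → ∃ m : ℕ, 0 < m ∧ K * (m : ℝ) ^ (-s) < w (2 * m + 1))
    {y : RealLp Γ p} (hy : y ∈ YSpace Γ p)
    (h : ∀ A : Finset Γ, ‖lpTruncate Γ p A y‖ ≤ 1 - w (2 * A.card + 1)) : ‖y‖ < 1 := by
  obtain ⟨q, hq0, hqp, hyq⟩ := hy
  obtain ⟨s, K, hs, hA⟩ := exists_finset_card_le_tail_le hp hq0 hqp y hyq
  obtain ⟨m, hm0, hm⟩ := hdom s K hs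
  obtain ⟨A, hAm, hAy⟩ := hA m hm0
  have hp1 : 1 ≤ p.toReal := by
    simpa using (ENNReal.toReal_le_toReal ENNReal.one_ne_top hp).2 (Fact.out : 1 ≤ p)
  have h1 : ‖lpTruncate Γ p A y‖ ≤ 1 - w (2 * m + 1) :=
    (h A).trans (by linarith [hanti.antitone (show 2 * A.card + 1 ≤ 2 * m + 1 by omega)])
  -- The truncated norm is at most `1` and `p ≥ 1`, so its `p`-th power also stays below `1 - w (2 *
  -- m + 1)`; the smaller tail cannot make up the deficit.
  have h2 : ‖lpTruncate Γ p A y‖ ^ p.toReal ≤ ‖lpTruncate Γ p A y‖ :=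
    (Real.rpow_le_rpow_of_exponent_ge' (norm_nonneg _) (by linarith [hpos (2 * m + 1)])
      zero_le_one hp1).trans_eq (Real.rpow_one _)
  by_contra! hy1
  linarith [Real.one_le_rpow hy1 (zero_le_one.trans hp1)]

open Classical in
theorem dense_YSpace (hp : p ≠ ⊤) : Dense (YSpace Γ p : Set (RealLp Γ p)) := by
  intro y
  refine mem_closure_of_tendsto (lp.hasSum_single hp y) (Eventually.of_forall fun A => ?_)
  refine Submodule.sum_mem _ fun i _ => ?_
  obtain ⟨q, hq0, hqp⟩ := exists_between (one_pos.trans_le (Fact.out : 1 ≤ p))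
  exact ⟨q, hq0, hqp, (lp.single (E := fun _ : Γ => ℝ) q i (y i)).2⟩

theorem image_coe_YSpace :
    (fun (y : RealLp Γ p) (γ : Γ) => y γ) '' (YSpace Γ p : Set (RealLp Γ p))
      = ⋃ q ∈ Set.Ioo 0 p, {f : Γ → ℝ | Memℓp f q} := by
  ext f
  simp only [Set.mem_iUnion, Set.mem_image]
  constructor
  · rintro ⟨y, ⟨q, hq0, hqp, hy⟩, rfl⟩
    exact ⟨q, ⟨hq0, hqp⟩, hy⟩
  · rintro ⟨q, ⟨hq0, hqp⟩, hf⟩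
    exact ⟨⟨f, Memℓp.of_exponent_ge hf hqp.le⟩, ⟨q, hq0, hqp, hf⟩, rfl⟩

end Truncation

/-! ### The body in `𝒴_p` and its gauge. -/

section Construction

variable {Γ : Type*} {p : ℝ≥0∞} [Fact (1 ≤ p)]

theorem exists_norming_family {w : ℕ → ℝ} (hanti : StrictAnti w) (hlt : ∀ n, w n < 1) :
    ∃ (F : Finset Γ → Finset (StrongDual ℝ (RealLp Γ p))) (r : ℕ → ℝ → ℝ),
      (∀ A, ∀ f ∈ F A, ‖f‖ ≤ 1) ∧ (∀ n, ContDiff ℝ ∞ (r n)) ∧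
      (∀ n, ConvexOn ℝ Set.univ (r n)) ∧ (∀ n s, r n (-s) = r n s) ∧ (∀ n s, 0 ≤ r n s) ∧
      (∀ n s, |s| ≤ 1 - w (2 * n) → r n s = 0) ∧
      ∀ A y, (∀ f ∈ F A, r A.card (f (lpTruncate Γ p A y)) ≤ 1) →
        ‖lpTruncate Γ p A y‖ ≤ 1 - w (2 * A.card + 1) := by
  let a : ℕ → ℝ := fun n => 1 - w (2 * n)
  let c : ℕ → ℝ := fun n => 1 - w (2 * n + 1)
  -- `b` leaves room on both sides: `a < b` for the transition of `r`, and `b < c` to absorb the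
  -- norming constant `b / c < 1`.
  let b : ℕ → ℝ := fun n => (a n + c n) / 2
  have hac : ∀ n, a n < c n := fun n => sub_lt_sub_left (hanti (Nat.lt_succ_self _)) 1
  have ha : ∀ n, 0 < a n := fun n => sub_pos.2 (hlt _)
  have hc : ∀ n, 0 < c n := fun n => sub_pos.2 (hlt _)
  have hab : ∀ n, a n < b n := fun n => left_lt_add_div_two.2 (hac n)
  have hbc : ∀ n, b n < c n := fun n => add_div_two_lt_right.2 (hac n)
  choose r hsm hconv heven hnn hzero hle using fun n => exists_contDiff_convexOn_even (hab n)
  choose F hF1 hF2 using fun A : Finset Γ =>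
    exists_finset_dual_norming_lpTruncate (p := p) A ((div_lt_one (hc A.card)).2 (hbc A.card))
  refine ⟨F, r, hF1, hsm, hconv, heven, hnn, hzero, fun A y h => ?_⟩
  have hb0 : 0 < b A.card := (ha _).trans (hab _)
  have h1 := hF2 A y (b A.card) hb0.le fun f hf => hle _ _ (h f hf)
  rw [div_mul_eq_mul_div, div_le_iff₀ (hc A.card)] at h1
  exact le_of_mul_le_mul_left h1 hb0

/-- The functional on `𝒴_p` evaluating a functional of `ℓ_p(Γ)` on a truncation. -/
noncomputable def truncatedFunctional (A : Finset Γ) (f : StrongDual ℝ (RealLp Γ p)) :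
    StrongDual ℝ (YSpace Γ p) :=
  (f ∘L lpTruncate Γ p A) ∘L (YSpace Γ p).subtypeL

theorem truncatedFunctional_apply (A : Finset Γ) (f : StrongDual ℝ (RealLp Γ p))
    (y : YSpace Γ p) : truncatedFunctional A f y = f (lpTruncate Γ p A y) :=
  rfl

theorem abs_truncatedFunctional_le (A : Finset Γ) {f : StrongDual ℝ (RealLp Γ p)} (hf : ‖f‖ ≤ 1)
    (y : YSpace Γ p) : |truncatedFunctional A f y| ≤ ‖lpTruncate Γ p A y‖ := by
  simpa [truncatedFunctional_apply] using f.le_of_opNorm_le hf (lpTruncate Γ p A y)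

theorem eventually_abs_truncatedFunctional_le (hp : p ≠ ⊤) {w : ℕ → ℝ} (hanti : StrictAnti w)
    (hw0 : Tendsto w atTop (𝓝 0)) {x : YSpace Γ p} (hx : ‖x‖ < 1)
    (hxA : ∀ A : Finset Γ, ‖lpTruncate Γ p A x‖ ≤ 1 - w (2 * A.card + 1)) :
    ∃ B : Finset Γ, ∀ᶠ y in 𝓝 x, ∀ A : Finset Γ, ¬A ⊆ B →
      ∀ f : StrongDual ℝ (RealLp Γ p), ‖f‖ ≤ 1 →
        |truncatedFunctional A f y| ≤ 1 - w (2 * A.card) := by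
  classical
  have hη : 0 < (1 - ‖x‖) / 2 := by linarith
  obtain ⟨n₁, hn₁⟩ := eventually_atTop.1 (hw0.eventually (gt_mem_nhds hη))
  -- With `n = |A| - 1`, this is the gap between the bound known for `A.erase γ` and the one needed
  -- for `A`. Half of `g` pays for the coordinate `γ`, half for moving from `x` to `y`.
  have hgap : ∀ᶠ g : ℝ in 𝓝[>] 0, ∀ n ∈ Finset.range n₁, g < w (2 * n + 1) - w (2 * n + 2) :=
    (Finset.eventually_all _).2 fun n _ => nhdsWithin_le_nhds
      (gt_mem_nhds (sub_pos.2 (hanti (Nat.lt_succ_self _))))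
  obtain ⟨g, ⟨hg, hgη⟩, hg0⟩ := ((hgap.and (nhdsWithin_le_nhds (gt_mem_nhds hη))).and
    self_mem_nhdsWithin).exists
  replace hg0 : 0 < g := hg0
  have hfin := (lp.memℓp (x : RealLp Γ p)).finite_setOf_lt_norm (toReal_pos_of_fact hp)
    (half_pos hg0)
  refine ⟨hfin.toFinset, ?_⟩
  filter_upwards [Metric.ball_mem_nhds x (half_pos hg0)] with y hy A hA f hf
  rw [mem_ball_iff_norm] at hy
  refine (abs_truncatedFunctional_le A hf y).trans ?_
  obtain ⟨γ, hγA, hγB⟩ := Finset.not_subset.1 hA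
  have hγ : |(x : RealLp Γ p) γ| ≤ g / 2 := not_lt.1 fun h => hγB (hfin.mem_toFinset.2 h)
  rcases le_or_gt n₁ A.card with hn | hn
  · have h1 : ‖lpTruncate Γ p A y‖ ≤ ‖y‖ := norm_lpTruncate_le hp A y
    have h2 : ‖y‖ ≤ ‖x‖ + ‖y - x‖ := norm_le_norm_add_norm_sub' y x
    linarith [hn₁ (2 * A.card) (by omega)]
  · have hcard : (A.erase γ).card + 1 = A.card := Finset.card_erase_add_one hγA
    have h1 : ‖lpTruncate Γ p A y‖ ≤ ‖lpTruncate Γ p A x‖ + ‖y - x‖ := by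
      have h2 : lpTruncate Γ p A y = lpTruncate Γ p A x + lpTruncate Γ p A (y - x) := by
        rw [← map_add, add_sub_cancel]
      rw [h2]
      exact (norm_add_le _ _).trans (add_le_add le_rfl (norm_lpTruncate_le hp A _))
    have h3 := norm_lpTruncate_le_erase hγA (x : RealLp Γ p)
    have h4 := hg _ (Finset.mem_range.2 (show (A.erase γ).card < n₁ by omega))
    rw [← hcard, show 2 * ((A.erase γ).card + 1) = 2 * (A.erase γ).card + 2 by ring]
    linarith [hxA (A.erase γ)]

theorem exists_isLFCNorm_YSpace (hp : p ≠ ⊤) {δ : ℝ} (hδ0 : 0 < δ) (hδ1 : δ < 1) :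
    ∃ N : Seminorm ℝ (YSpace Γ p), IsLFCNorm N ∧ ∀ y, ‖y‖ ≤ N y ∧ (1 - δ) * N y ≤ ‖y‖ := by
  classical
  obtain ⟨w, hanti, hpos, hwδ, hw0, hdom⟩ := exists_strictAnti_dominating_rpow hδ0
  obtain ⟨F, r, hF, hsm, hconv, heven, hnn, hzero, hnorm⟩ :=
    exists_norming_family (Γ := Γ) (p := p) hanti fun n => (hwδ n).trans hδ1
  let ι := Σ A : Finset Γ, {f // f ∈ F A}
  let φ : ι → StrongDual ℝ (YSpace Γ p) := fun i => truncatedFunctional i.1 i.2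
  let ρ : ι → ℝ → ℝ := fun i => r i.1.card
  let C := sublevelBody φ ρ
  have hz : ∀ i, ρ i 0 = 0 := fun i => hzero _ _ (by
    rw [abs_zero]
    linarith [hwδ (2 * i.1.card)])
  have hCA : ∀ x ∈ C, ∀ A, ‖lpTruncate Γ p A x‖ ≤ 1 - w (2 * A.card + 1) := fun x hx A =>
    hnorm A x fun f hf =>
    (Finset.sum_singleton (fun i => ρ i (φ i x)) (⟨A, f, hf⟩ : ι)).symm.trans_le (hx _)
  have hC1 : ∀ x ∈ C, ‖x‖ < 1 := fun x hx =>
    norm_lt_one_of_norm_lpTruncate_le hp hanti hpos hdom x.2 (hCA x hx)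
  have hball : Metric.ball 0 (1 - δ) ⊆ C := fun x hx J => by
    rw [mem_ball_zero_iff] at hx
    rw [Finset.sum_eq_zero fun i _ => hzero _ _ ?_]
    · exact zero_le_one
    · refine (abs_truncatedFunctional_le i.1 (hF _ _ i.2.2) x).trans ?_
      have h1 : ‖lpTruncate Γ p i.1 x‖ ≤ ‖x‖ := norm_lpTruncate_le hp i.1 x
      linarith [hwδ (2 * i.1.card)]
  have hC0 : C ∈ 𝓝 0 := mem_of_superset (Metric.ball_mem_nhds 0 (sub_pos.2 hδ1)) hball
  have hloc : ∀ x ∈ C, ∃ J : Finset ι, ∀ᶠ y in 𝓝 x, ∀ i ∉ J, ρ i (φ i y) = 0 := by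
    intro x hx
    obtain ⟨B, hB⟩ := eventually_abs_truncatedFunctional_le hp hanti hw0 (hC1 x hx) (hCA x hx)
    refine ⟨B.powerset.sigma fun A => (F A).attach, ?_⟩
    filter_upwards [hB] with y hy i hi
    refine hzero _ _ (hy i.1 (fun hiB => hi ?_) i.2 (hF _ _ i.2.2))
    exact Finset.mem_sigma.2 ⟨Finset.mem_powerset.2 hiB, Finset.mem_attach _ _⟩
  have hCabs : Absorbent ℝ C := absorbent_nhds_zero hC0
  let N : Seminorm ℝ (YSpace Γ p) := gaugeSeminorm
    (balanced_sublevelBody (fun i => hconv _) (fun i => heven _) hz)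
    (convex_sublevelBody fun i => hconv _) hCabs
  have hlow : ∀ y, ‖y‖ ≤ N y := fun y => by
    have h1 := le_gauge_of_subset_closedBall hCabs zero_le_one
      (fun x hx => mem_closedBall_zero_iff.2 (hC1 x hx).le) (x := y)
    rwa [div_one] at h1
  refine ⟨N, fun x hx => ?_, fun y => ⟨hlow y, mul_gauge_le_norm hball⟩⟩
  obtain ⟨k, ψ, G, hG, hev⟩ := exists_smooth_gauge_sublevelBody (fun i => hsm _)
    (fun i => hconv _) hz (fun i => hnn _) hC0 hloc ((norm_pos_iff.2 hx).trans_le (hlow x))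
  obtain ⟨U, hU, hUo, hxU⟩ := mem_nhds_iff.1 hev
  exact ⟨U, hUo, hxU, k, ψ, G, hG, fun y hy => hU hy⟩

end Construction

theorem mainTheorem1 (Γ : Type*) [Infinite Γ] (p : ℝ≥0∞) [Fact (1 ≤ p)] (hp : p ≠ ⊤) :
    (fun (y : RealLp Γ p) (γ : Γ) => y γ) '' (YSpace Γ p : Set (RealLp Γ p))
        = ⋃ q ∈ Set.Ioo 0 p, {f : Γ → ℝ | Memℓp f q} ∧
    Dense (YSpace Γ p : Set (RealLp Γ p)) ∧
    ∀ ε : ℝ, 0 < ε → ∃ N : Seminorm ℝ (YSpace Γ p),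
      IsEquivalentNorm N ∧ IsSmoothNorm N ∧ IsLFCNorm N ∧
      ∀ y : YSpace Γ p, (1 - ε) * N y ≤ ‖y‖ ∧ ‖y‖ ≤ (1 + ε) * N y := by
  refine ⟨image_coe_YSpace, dense_YSpace hp, fun ε hε => ?_⟩
  -- `ε` may be `1` or more, whereas the inner ball of radius `1 - δ` needs `δ < 1`.
  obtain ⟨δ, hδ0, hδ⟩ := exists_between (lt_min hε one_pos)
  obtain ⟨hδε, hδ1⟩ := lt_min_iff.1 hδ
  obtain ⟨N, hLFC, hN⟩ := exists_isLFCNorm_YSpace (Γ := Γ) hp hδ0 hδ1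
  have h1 : 0 < 1 - δ := sub_pos.2 hδ1
  refine ⟨N, ⟨1, (1 - δ)⁻¹, one_pos, inv_pos.2 h1, fun y => ⟨?_, ?_⟩⟩, hLFC.isSmoothNorm, hLFC,
    fun y => ⟨?_, ?_⟩⟩
  · simpa using (hN y).1
  · rw [inv_mul_eq_div, le_div_iff₀ h1, mul_comm]
    exact (hN y).2
  · exact (mul_le_mul_of_nonneg_right (by linarith) (apply_nonneg N y)).trans (hN y).2
  · exact (hN y).1.trans (le_mul_of_one_le_left (apply_nonneg N y) (by linarith))
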